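/- **Theorem 4.1 (Strong Comparison Principle).** Let $N\ge 1$ and $0<\mu<N$. Let $f:[0,\infty)\to\mathbb R$ be continuous and monotone (nondecreasing, or nonincreasing) with $f(0)=0$, and let $F(s)=\int_0^s f(t)\,dt$. Let $\Gamma\subset\{x\in\mathbb R^N:x_1=0\}$ be compact. For $\lambda\in\mathbb R$ put $$\Sigma_\lambda=\{x\in\mathbb R^N:x_1<\lambda\},\qquad R_\lambda(x)=(2\lambda-x_1,x_2,\dots,x_N),\qquad \Sigma'_\lambda=\Sigma_\lambda\setminus R_\lambda(\Gamma),$$ and suppose that the open set $\Sigma'_\lambda$ is connected. Let $u:\mathbb R^N\to\mathbb R$ satisfy $u\ge 0$ on $\mathbb R^N\setminus\Gamma$, let $u_\lambda=u\circ R_\lambda$, and suppose that $u$ and $u_\lambda$ are continuous on $\Sigma'_\lambda$ and have weak gradients in $L^1_{\rm loc}(\Sigma'_\lambda)$. Suppose that the integrals $$v(x)=\int_{\mathbb R^N\setminus\Gamma}\frac{F(u(y))}{|x-y|^\mu}\,dy,\qquad v_\lambda(x)=\int_{\mathbb R^N\setminus R_\lambda(\Gamma)}\frac{F(u_\lambda(y))}{|x-y|^\mu}\,dy$$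 converge absolutely for almost every $x\in\Sigma'_\lambda$, that $v\,f(u)$ and $v_\lambda f(u_\lambda)$ belong to $L^1_{\rm loc}(\Sigma'_\lambda)$, and that for every nonnegative $\varphi\in C^1_c(\Sigma'_\lambda)$ $$\int_{\Sigma'_\lambda}\nabla u_\lambda\cdot\nabla\varphi\,dx-\int_{\Sigma'_\lambda}v_\lambda(x)f(u_\lambda(x))\varphi(x)\,dx\ \ge 0,\qquad \int_{\Sigma'_\lambda}\nabla u\cdot\nabla\varphi\,dx-\int_{\Sigma'_\lambda}v(x)f(u(x))\varphi(x)\,dx\ \le 0 .$$ If $u\le u_\lambda$ in $\Sigma'_\lambda$, then either $u\equiv u_\lambda$ in $\Sigma'_\lambda$ or $u<u_\lambda$ in $\Sigma'_\lambda$. -/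

import Mathlib

open MeasureTheory Set
open scoped ContDiff

namespace Hartree

noncomputable section

/-- The reflection `x ↦ (2 * lam - x₁, x₂, …, x_N)` across the hyperplane `{x₁ = lam}`.
The coordinate `x₁` of the usual notation is `x 0`. -/
def reflection {N : ℕ} [NeZero N] (lam : ℝ) (x : EuclideanSpace ℝ (Fin N)) :
    EuclideanSpace ℝ (Fin N) :=
  WithLp.toLp 2 (Function.update x.ofLp 0 (2 * lam - x 0))

/-- The open half space `{x₁ < lam}`. -/
def halfSpace (N : ℕ) [NeZero N] (lam : ℝ) : Set (EuclideanSpace ℝ (Fin N)) :=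
  {x | x 0 < lam}

/-- The half space `{x₁ < lam}` without the reflected singular set. -/
def puncturedHalfSpace {N : ℕ} [NeZero N] (lam : ℝ) (Γ : Set (EuclideanSpace ℝ (Fin N))) :
    Set (EuclideanSpace ℝ (Fin N)) :=
  halfSpace N lam \ (reflection lam '' Γ)

/-- The reflected function `u_lam (x) = u (x_lam)`. -/
def reflected {N : ℕ} [NeZero N] (lam : ℝ) (u : EuclideanSpace ℝ (Fin N) → ℝ) :
    EuclideanSpace ℝ (Fin N) → ℝ :=
  fun x => u (reflection lam x)

/-- The primitive `F` of `f` with `F 0 = 0`. -/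
def primitive (f : ℝ → ℝ) (s : ℝ) : ℝ := ∫ t in (0 : ℝ)..s, f t

/-- The integrand `y ↦ F (w y) / |x - y| ^ μ` of the nonlocal coefficient at the point `x`. -/
def potentialIntegrand {N : ℕ} (μ : ℝ) (f : ℝ → ℝ) (w : EuclideanSpace ℝ (Fin N) → ℝ)
    (x y : EuclideanSpace ℝ (Fin N)) : ℝ :=
  primitive f (w y) / ‖x - y‖ ^ μ

/-- The nonlocal coefficient `x ↦ ∫_{ℝ^N ∖ Z} F (w y) / |x - y| ^ μ dy`. -/
def potential {N : ℕ} (μ : ℝ) (f : ℝ → ℝ) (Z : Set (EuclideanSpace ℝ (Fin N)))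
    (w : EuclideanSpace ℝ (Fin N) → ℝ) (x : EuclideanSpace ℝ (Fin N)) : ℝ :=
  ∫ y in Zᶜ, potentialIntegrand μ f w x y

/-- `G` is the weak (distributional) gradient of `w` on the open set `Ω`. -/
structure IsWeakGradient {N : ℕ} (Ω : Set (EuclideanSpace ℝ (Fin N)))
    (w : EuclideanSpace ℝ (Fin N) → ℝ)
    (G : EuclideanSpace ℝ (Fin N) → EuclideanSpace ℝ (Fin N)) : Prop where
  locallyIntegrable : LocallyIntegrableOn w Ω
  locallyIntegrable_grad : LocallyIntegrableOn G Ω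
  integral_eq : ∀ φ : EuclideanSpace ℝ (Fin N) → ℝ,
    ContDiff ℝ ∞ φ → HasCompactSupport φ → tsupport φ ⊆ Ω →
      ∫ x in Ω, w x • gradient φ x = -∫ x in Ω, φ x • G x

/-- All terms in the weak form on `Ω` of `-Δ w = (∫_{ℝ^N ∖ Z} F (w y) / |x - y| ^ μ dy) f (w)`
are meaningful: `G` is the weak gradient of `w`, the nonlocal coefficient is given by a convergent
integral at almost every point of `Ω`, and the right-hand side is locally integrable on `Ω`. -/
structure WeakFormDefined {N : ℕ} (μ : ℝ) (f : ℝ → ℝ) (Z Ω : Set (EuclideanSpace ℝ (Fin N)))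
    (w : EuclideanSpace ℝ (Fin N) → ℝ)
    (G : EuclideanSpace ℝ (Fin N) → EuclideanSpace ℝ (Fin N)) : Prop where
  isWeakGradient : IsWeakGradient Ω w G
  integrable_potential : ∀ᵐ x ∂(volume.restrict Ω), IntegrableOn (potentialIntegrand μ f w x) Zᶜ
  locallyIntegrable_rhs : LocallyIntegrableOn (fun x => potential μ f Z w x * f (w x)) Ω

/-- The weak form `∫_Ω ∇w · ∇φ - ∫_Ω (∫_{ℝ^N ∖ Z} F (w y) / |x - y| ^ μ dy) f (w x) φ x dx`,
where `G` stands for the gradient of `w`. -/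
def weakForm {N : ℕ} (μ : ℝ) (f : ℝ → ℝ) (Z Ω : Set (EuclideanSpace ℝ (Fin N)))
    (w : EuclideanSpace ℝ (Fin N) → ℝ)
    (G : EuclideanSpace ℝ (Fin N) → EuclideanSpace ℝ (Fin N))
    (φ : EuclideanSpace ℝ (Fin N) → ℝ) : ℝ :=
  (∫ x in Ω, inner ℝ (G x) (gradient φ x)) - ∫ x in Ω, potential μ f Z w x * f (w x) * φ x

/-- `w` is a weak supersolution on `Ω` of the Hartree equation with singular set `Z`; the test
functions are the nonnegative functions in `C¹_c(Ω)`. -/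
def IsWeakSupersolution {N : ℕ} (μ : ℝ) (f : ℝ → ℝ) (Z Ω : Set (EuclideanSpace ℝ (Fin N)))
    (w : EuclideanSpace ℝ (Fin N) → ℝ) : Prop :=
  ∃ G : EuclideanSpace ℝ (Fin N) → EuclideanSpace ℝ (Fin N),
    WeakFormDefined μ f Z Ω w G ∧
      ∀ φ : EuclideanSpace ℝ (Fin N) → ℝ,
        ContDiff ℝ 1 φ → HasCompactSupport φ → tsupport φ ⊆ Ω → (∀ x, 0 ≤ φ x) →
          0 ≤ weakForm μ f Z Ω w G φ

/-- `w` is a weak subsolution on `Ω` of the Hartree equation with singular set `Z`; the test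
functions are the nonnegative functions in `C¹_c(Ω)`. -/
def IsWeakSubsolution {N : ℕ} (μ : ℝ) (f : ℝ → ℝ) (Z Ω : Set (EuclideanSpace ℝ (Fin N)))
    (w : EuclideanSpace ℝ (Fin N) → ℝ) : Prop :=
  ∃ G : EuclideanSpace ℝ (Fin N) → EuclideanSpace ℝ (Fin N),
    WeakFormDefined μ f Z Ω w G ∧
      ∀ φ : EuclideanSpace ℝ (Fin N) → ℝ,
        ContDiff ℝ 1 φ → HasCompactSupport φ → tsupport φ ⊆ Ω → (∀ x, 0 ≤ φ x) →
          weakForm μ f Z Ω w G φ ≤ 0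

end

end Hartree

/-! Put `w = reflected lam u - u`, which is continuous and nonnegative. The point is that `w` is
weakly superharmonic, so that the strong minimum principle applies.

Folding `∫ F(u_lam)/|x-y|^μ - ∫ F(u)/|x-y|^μ` by `y ↦ reflection lam y` produces the product of
`F(u_lam y) - F(u y)` and the difference of the kernels at `y` and at its mirror image. On either
side of the hyperplane these factors have the same sign when `f` is nondecreasing, so the
coefficients are ordered (`potential_le_potential_reflected`), and so are the right-hand sides
(`rhs_le_rhs_reflected`). A nonincreasing `f` is reduced to `-f`.

The minimum principle is proved without regularity theory. The bump averages of `w` around `x₀` are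
nondecreasing in the concentration `c` (`bumpAverage_monotoneOn`) and tend to a multiple of `w x₀`
as `c → ∞`. If `w x₀ = 0`, every average is therefore zero and `w` vanishes near `x₀`
(`exists_ball_forall_eq_zero`); connectedness does the rest. -/

namespace Hartree

/-! ### Geometry of the reflection and null sets. -/

section Reflection

variable {N : ℕ} [NeZero N] {lam : ℝ}

lemma reflection_apply (x : EuclideanSpace ℝ (Fin N)) (i : Fin N) :
    reflection lam x i = if i = 0 then 2 * lam - x 0 else x i := by
  simp [reflection, Function.update_apply]

lemma reflection_apply_zero (x : EuclideanSpace ℝ (Fin N)) :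
    reflection lam x 0 = 2 * lam - x 0 := by
  simp [reflection_apply]

lemma reflection_reflection (x : EuclideanSpace ℝ (Fin N)) :
    reflection lam (reflection lam x) = x := by
  ext i
  by_cases hi : i = 0
  · subst hi; simp [reflection_apply]
  · simp [reflection_apply, hi]

lemma reflection_eq_self {x : EuclideanSpace ℝ (Fin N)} (hx : x 0 = lam) :
    reflection lam x = x := by
  ext i
  by_cases hi : i = 0
  · subst hi; simp [reflection_apply, hx]; ring
  · simp [reflection_apply, hi]

lemma mem_image_reflection {Γ : Set (EuclideanSpace ℝ (Fin N))} {x : EuclideanSpace ℝ (Fin N)} :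
    x ∈ reflection lam '' Γ ↔ reflection lam x ∈ Γ := by
  constructor
  · rintro ⟨y, hy, rfl⟩
    rwa [reflection_reflection]
  · exact fun h => ⟨_, h, reflection_reflection x⟩

lemma isometry_reflection : Isometry (reflection (N := N) lam) := by
  refine Isometry.of_dist_eq fun x y => ?_
  rw [EuclideanSpace.dist_eq, EuclideanSpace.dist_eq]
  congr 1
  refine Finset.sum_congr rfl fun i _ => ?_
  by_cases hi : i = 0
  · subst hi
    simp only [reflection_apply, if_true, Real.dist_eq, sq_abs]
    ring
  · simp [reflection_apply, hi]

/-- Only the first coordinate differs: with `a = lam - x 0` and `b = lam - y 0` this is `(a + b)² -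
(a - b)² = 4ab`. -/
lemma norm_sub_reflection_sq (x y : EuclideanSpace ℝ (Fin N)) :
    ‖x - reflection lam y‖ ^ 2 = ‖x - y‖ ^ 2 + 4 * ((lam - x 0) * (lam - y 0)) := by
  have key : ∑ i, ((x i - reflection lam y i) ^ 2 - (x i - y i) ^ 2)
      = 4 * ((lam - x 0) * (lam - y 0)) := by
    rw [Finset.sum_eq_single 0]
    · rw [reflection_apply_zero]; ring
    · intro i _ hi
      simp [reflection_apply, hi]
    · simp
  rw [Finset.sum_sub_distrib] at key
  simp only [EuclideanSpace.norm_sq_eq, Real.norm_eq_abs, sq_abs, PiLp.sub_apply]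
  linarith

lemma norm_sub_le_norm_sub_reflection {x y : EuclideanSpace ℝ (Fin N)}
    (hx : x 0 ≤ lam) (hy : y 0 ≤ lam) : ‖x - y‖ ≤ ‖x - reflection lam y‖ := by
  refine le_of_sq_le_sq ?_ (norm_nonneg _)
  rw [norm_sub_reflection_sq]
  have := mul_nonneg (sub_nonneg.2 hx) (sub_nonneg.2 hy)
  linarith

/-- The reflection across `{x₁ = 0}` is a linear isometry, and the general one is that map followed
by translation by `2 * lam` along the first axis. -/
lemma measurePreserving_reflection : MeasurePreserving (reflection (N := N) lam) := by
  have h0 : Isometry (reflection (N := N) 0) := isometry_reflection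
  let L : EuclideanSpace ℝ (Fin N) ≃ₗᵢ[ℝ] EuclideanSpace ℝ (Fin N) :=
    { toFun := reflection 0
      invFun := reflection 0
      left_inv := reflection_reflection
      right_inv := reflection_reflection
      map_add' := fun x y => by
        ext i
        by_cases hi : i = 0
        · subst hi; simp [reflection_apply]; ring
        · simp [reflection_apply, hi]
      map_smul' := fun c x => by
        ext i
        by_cases hi : i = 0
        · subst hi; simp [reflection_apply]
        · simp [reflection_apply, hi]
      norm_map' := fun x => by
        have : reflection (N := N) 0 0 = 0 := reflection_eq_self rfl
        simpa [dist_eq_norm, this] using h0.dist_eq x 0 }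
  have e : reflection (N := N) lam
      = (fun x => EuclideanSpace.single (0 : Fin N) (2 * lam) + x) ∘ L := by
    funext x
    change _ = EuclideanSpace.single (0 : Fin N) (2 * lam) + reflection 0 x
    ext i
    by_cases hi : i = 0
    · subst hi; simp [reflection_apply]; ring
    · simp [reflection_apply, hi]
  rw [e]
  exact (measurePreserving_add_left volume _).comp L.measurePreserving

/-- `Γ` lies in a proper subspace. Being null, it can be ignored in the potentials, which become
integrals over the whole space. -/
lemma volume_eq_zero_of_forall_apply_zero_eq_zero {Γ : Set (EuclideanSpace ℝ (Fin N))}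
    (hΓ : ∀ x ∈ Γ, x 0 = 0) : volume Γ = 0 := by
  refine measure_mono_null (t := ((EuclideanSpace.proj (0 : Fin N) :
    EuclideanSpace ℝ (Fin N) →L[ℝ] ℝ).ker : Set (EuclideanSpace ℝ (Fin N)))) ?_
    (Measure.addHaar_submodule _ _ ?_)
  · intro x hx
    simpa using hΓ x hx
  · intro h
    have : EuclideanSpace.single (0 : Fin N) (1 : ℝ) ∈ (EuclideanSpace.proj (0 : Fin N) :
      EuclideanSpace ℝ (Fin N) →L[ℝ] ℝ).ker := by rw [h]; trivial
    simp at this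

lemma volume_image_reflection_eq_zero {Γ : Set (EuclideanSpace ℝ (Fin N))}
    (hΓ : volume Γ = 0) : volume (reflection lam '' Γ) = 0 := by
  have h : reflection lam '' Γ = reflection lam ⁻¹' Γ := by
    ext x; exact mem_image_reflection
  rw [h]
  exact measurePreserving_reflection.quasiMeasurePreserving.preimage_null hΓ

lemma isOpen_puncturedHalfSpace {Γ : Set (EuclideanSpace ℝ (Fin N))} (hΓ : IsCompact Γ) :
    IsOpen (puncturedHalfSpace lam Γ) := by
  refine IsOpen.sdiff ?_ (hΓ.image isometry_reflection.continuous).isClosed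
  exact isOpen_lt (by fun_prop) continuous_const

end Reflection

/-! ### Comparison of the nonlocal coefficients and right-hand sides. -/

section Potential

variable {N : ℕ} {μ : ℝ} {f : ℝ → ℝ}

lemma primitive_monotoneOn (hfc : ContinuousOn f (Ici 0)) (hf0 : f 0 = 0)
    (hfm : MonotoneOn f (Ici 0)) : MonotoneOn (primitive f) (Ici 0) := by
  intro a ha b hb hab
  have ha' : (0 : ℝ) ≤ a := ha
  have hb' : (0 : ℝ) ≤ b := hb
  have hi : ∀ c : ℝ, 0 ≤ c → ∀ d : ℝ, 0 ≤ d → IntervalIntegrable f volume c d := fun c hc d hd =>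
    (hfc.mono fun t ht => (le_min hc hd).trans ht.1).intervalIntegrable
  have h := intervalIntegral.integral_interval_sub_left (hi 0 le_rfl b hb') (hi 0 le_rfl a ha')
  have hpos : 0 ≤ ∫ t in a..b, f t := intervalIntegral.integral_nonneg hab fun t ht => by
    have ht0 : 0 ≤ t := ha'.trans ht.1
    rw [← hf0]
    exact hfm self_mem_Ici ht0 ht0
  rw [← sub_nonneg]
  exact hpos.trans_eq h.symm

lemma primitive_zero : primitive f 0 = 0 := by simp [primitive]

lemma primitive_nonneg (hfc : ContinuousOn f (Ici 0)) (hf0 : f 0 = 0)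
    (hfm : MonotoneOn f (Ici 0)) {s : ℝ} (hs : 0 ≤ s) : 0 ≤ primitive f s := by
  rw [← primitive_zero (f := f)]
  exact primitive_monotoneOn hfc hf0 hfm self_mem_Ici hs hs

lemma primitive_neg (s : ℝ) : primitive (-f) s = -primitive f s := by
  simp [primitive]

lemma potentialIntegrand_neg (w : EuclideanSpace ℝ (Fin N) → ℝ)
    (x y : EuclideanSpace ℝ (Fin N)) :
    potentialIntegrand μ (-f) w x y = -potentialIntegrand μ f w x y := by
  simp [potentialIntegrand, primitive_neg, neg_div]

lemma potential_neg (Z : Set (EuclideanSpace ℝ (Fin N))) (w : EuclideanSpace ℝ (Fin N) → ℝ)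
    (x : EuclideanSpace ℝ (Fin N)) : potential μ (-f) Z w x = -potential μ f Z w x := by
  simp [potential, potentialIntegrand_neg, integral_neg]

lemma potential_nonneg (hfc : ContinuousOn f (Ici 0)) (hf0 : f 0 = 0)
    (hfm : MonotoneOn f (Ici 0)) {Z : Set (EuclideanSpace ℝ (Fin N))} (hZ : volume Z = 0)
    {w : EuclideanSpace ℝ (Fin N) → ℝ} (hw : ∀ x ∉ Z, 0 ≤ w x) (x : EuclideanSpace ℝ (Fin N)) :
    0 ≤ potential μ f Z w x := by
  have hZ' : ∀ᵐ y ∂(volume : Measure (EuclideanSpace ℝ (Fin N))), y ∉ Z :=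
    measure_eq_zero_iff_ae_notMem.1 hZ
  refine integral_nonneg_of_ae ?_
  filter_upwards [ae_restrict_of_ae hZ'] with y hy
  exact div_nonneg (primitive_nonneg hfc hf0 hfm (hw y hy)) (by positivity)

lemma restrict_compl_of_null {Z : Set (EuclideanSpace ℝ (Fin N))} (hZ : volume Z = 0) :
    (volume : Measure (EuclideanSpace ℝ (Fin N))).restrict Zᶜ = volume :=
  Measure.restrict_eq_self_of_ae_mem (measure_eq_zero_iff_ae_notMem.1 hZ)

variable [NeZero N] {lam : ℝ} {Γ : Set (EuclideanSpace ℝ (Fin N))}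
  {u : EuclideanSpace ℝ (Fin N) → ℝ}

lemma potential_le_potential_reflected (hμ : 0 < μ) (hfc : ContinuousOn f (Ici 0)) (hf0 : f 0 = 0)
    (hfm : MonotoneOn f (Ici 0)) (hΓ : volume Γ = 0) (hu0 : ∀ x ∉ Γ, 0 ≤ u x)
    (hle : ∀ x ∈ puncturedHalfSpace lam Γ, u x ≤ reflected lam u x)
    {x : EuclideanSpace ℝ (Fin N)} (hx : x 0 < lam)
    (hu : IntegrableOn (potentialIntegrand μ f u x) Γᶜ)
    (hul : IntegrableOn (potentialIntegrand μ f (reflected lam u) x) (reflection lam '' Γ)ᶜ) :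
    potential μ f Γ u x ≤ potential μ f (reflection lam '' Γ) (reflected lam u) x := by
  have hΓ' := volume_image_reflection_eq_zero (lam := lam) hΓ
  unfold potential
  rw [IntegrableOn, restrict_compl_of_null hΓ] at hu
  rw [IntegrableOn, restrict_compl_of_null hΓ'] at hul
  rw [restrict_compl_of_null hΓ, restrict_compl_of_null hΓ']
  set g : EuclideanSpace ℝ (Fin N) → ℝ := fun y =>
    potentialIntegrand μ f (reflected lam u) x y - potentialIntegrand μ f u x y with hg
  have hgi : Integrable g := hul.sub hu
  have hR := measurePreserving_reflection (N := N) (lam := lam)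
  have hRe : MeasurableEmbedding (reflection (N := N) lam) :=
    (isometry_reflection.isEmbedding.measurableEmbedding (by
      rw [range_eq_univ.2 fun y => ⟨_, reflection_reflection y⟩]
      exact MeasurableSet.univ))
  have hgR : ∫ y, g (reflection lam y) = ∫ y, g y := hR.integral_comp hRe g
  have hgRi : Integrable (fun y => g (reflection lam y)) := (hR.integrable_comp_emb hRe).2 hgi
  -- Since the reflection preserves measure, this integral is twice `∫ g`, and unlike `g` its
  -- integrand has a sign.
  have hsum : 0 ≤ ∫ y, (g y + g (reflection lam y)) := by
    refine integral_nonneg_of_ae ?_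
    -- The two poles `y = x` and `y = reflection lam x` are discarded so that both distances are
    -- positive when reciprocals are compared.
    have hne : ∀ z : EuclideanSpace ℝ (Fin N), ∀ᵐ y, y ≠ z := fun z =>
      Measure.ae_ne volume z
    filter_upwards [measure_eq_zero_iff_ae_notMem.1 hΓ, measure_eq_zero_iff_ae_notMem.1 hΓ',
      hne x, hne (reflection lam x)] with y hy hy' hyx hyx'
    have hF := primitive_monotoneOn hfc hf0 hfm
    have hRy : reflection lam y ∉ Γ := fun h => hy' (mem_image_reflection.2 h)
    have hp : 0 < ‖x - y‖ := norm_pos_iff.2 (sub_ne_zero.2 hyx.symm)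
    have hp' : 0 < ‖x - reflection lam y‖ := norm_pos_iff.2 (sub_ne_zero.2 fun h => hyx' (by
      rw [h, reflection_reflection]))
    have hrew : g y + g (reflection lam y)
        = (primitive f (u (reflection lam y)) - primitive f (u y))
          * ((‖x - y‖ ^ μ)⁻¹ - (‖x - reflection lam y‖ ^ μ)⁻¹) := by
      simp only [hg, potentialIntegrand, reflected, reflection_reflection]
      ring
    change 0 ≤ g y + g (reflection lam y)
    rw [hrew]
    -- Both factors are nonnegative on the left, both nonpositive on the right, and both vanish on
    -- the hyperplane.
    rcases lt_trichotomy (y 0) lam with h | h | h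
    · refine mul_nonneg (sub_nonneg.2 (hF (hu0 y hy) (hu0 _ hRy) (hle y ⟨h, hy'⟩)))
        (sub_nonneg.2 (inv_anti₀ (by positivity) ?_))
      exact Real.rpow_le_rpow hp.le (norm_sub_le_norm_sub_reflection hx.le h.le) hμ.le
    · simp [reflection_eq_self h]
    · have h' : reflection lam y 0 < lam := by rw [reflection_apply_zero]; linarith
      have h1 := hle _ (show reflection lam y ∈ puncturedHalfSpace lam Γ from
        ⟨h', fun hc => hy (by rwa [mem_image_reflection, reflection_reflection] at hc)⟩)
      rw [reflected, reflection_reflection] at h1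
      refine mul_nonneg_of_nonpos_of_nonpos (sub_nonpos.2 (hF (hu0 _ hRy) (hu0 y hy) h1))
        (sub_nonpos.2 (inv_anti₀ (by positivity) ?_))
      have h2 := norm_sub_le_norm_sub_reflection hx.le h'.le
      rw [reflection_reflection] at h2
      exact Real.rpow_le_rpow hp'.le h2 hμ.le
  rw [integral_add hgi hgRi, hgR] at hsum
  have h3 : ∫ y, g y = _ := integral_sub hul hu
  linarith

/-- The right-hand sides of the two inequalities are ordered, whether `f` is nondecreasing or
nonincreasing. -/
lemma rhs_le_rhs_reflected (hμ : 0 < μ) (hfc : ContinuousOn f (Ici 0)) (hf0 : f 0 = 0)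
    (hfm : MonotoneOn f (Ici 0) ∨ AntitoneOn f (Ici 0)) (hΓ : volume Γ = 0)
    (hu0 : ∀ x ∉ Γ, 0 ≤ u x)
    (hle : ∀ x ∈ puncturedHalfSpace lam Γ, u x ≤ reflected lam u x)
    {x : EuclideanSpace ℝ (Fin N)} (hx : x ∈ puncturedHalfSpace lam Γ) (hxΓ : x ∉ Γ)
    (hu : IntegrableOn (potentialIntegrand μ f u x) Γᶜ)
    (hul : IntegrableOn (potentialIntegrand μ f (reflected lam u) x) (reflection lam '' Γ)ᶜ) :
    potential μ f Γ u x * f (u x) ≤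
      potential μ f (reflection lam '' Γ) (reflected lam u) x * f (reflected lam u x) := by
  -- Replacing `f` by `-f` changes the sign of both the potential and `f`, so their product is
  -- unchanged.
  wlog hm : MonotoneOn f (Ici 0) generalizing f with H
  · have ha : AntitoneOn f (Ici 0) := hfm.resolve_left hm
    have h := H (f := -f) hfc.neg (by simp [hf0]) (Or.inl ha.neg)
      (by
        rw [show potentialIntegrand μ (-f) u x = -potentialIntegrand μ f u x from
          funext fun y => potentialIntegrand_neg u x y]
        exact hu.neg)
      (by
        rw [show potentialIntegrand μ (-f) (reflected lam u) x
            = -potentialIntegrand μ f (reflected lam u) x from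
          funext fun y => potentialIntegrand_neg _ x y]
        exact hul.neg) ha.neg
    simpa [potential_neg] using h
  · have h1 := hu0 x hxΓ
    have h2 := hle x hx
    have h3 : 0 ≤ f (u x) := by
      rw [← hf0]; exact hm self_mem_Ici h1 h1
    have h4 := potential_nonneg (μ := μ) hfc hf0 hm hΓ hu0 x
    have h5 := potential_le_potential_reflected hμ hfc hf0 hm hΓ hu0 hle hx.1 hu hul
    exact mul_le_mul h5 (hm h1 (h1.trans h2) h2) h3 (h4.trans h5)

end Potential

/-! ### One-dimensional profiles. -/

section Bump

/-- A smooth nonnegative function on the line, positive exactly on `(-∞, 1)`. -/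
noncomputable def bump (t : ℝ) : ℝ := expNegInvGlue (1 - t)

lemma bump_nonneg (t : ℝ) : 0 ≤ bump t := expNegInvGlue.nonneg _

lemma bump_pos {t : ℝ} (ht : t < 1) : 0 < bump t := expNegInvGlue.pos_of_pos (by linarith)

lemma bump_eq_zero {t : ℝ} (ht : 1 ≤ t) : bump t = 0 :=
  expNegInvGlue.zero_of_nonpos (by linarith)

lemma contDiff_bump {n : ℕ∞} : ContDiff ℝ n bump :=
  expNegInvGlue.contDiff.comp (contDiff_const.sub contDiff_id)

lemma continuous_bump : Continuous bump := (contDiff_bump (n := 0)).continuous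

lemma hasDerivAt_bump (t : ℝ) : HasDerivAt bump (deriv bump t) t :=
  ((contDiff_bump (n := 1)).differentiable (by simp) t).hasDerivAt

lemma continuous_deriv_bump : Continuous (deriv bump) :=
  (contDiff_bump (n := 1)).continuous_deriv (by simp)

/-- Every `t ≥ 1`, the endpoint included, is a global minimum of `bump`. -/
lemma deriv_bump_eq_zero {t : ℝ} (ht : 1 ≤ t) : deriv bump t = 0 :=
  IsLocalMin.deriv_eq_zero (Filter.Eventually.of_forall fun s => by
    rw [bump_eq_zero ht]; exact bump_nonneg s)

/-- The antiderivative of `-bump` vanishing on `[1, ∞)`. -/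
noncomputable def bumpTail (t : ℝ) : ℝ := -∫ s in (1 : ℝ)..t, bump s

lemma hasDerivAt_bumpTail (t : ℝ) : HasDerivAt bumpTail (-bump t) t :=
  (intervalIntegral.integral_hasDerivAt_right (continuous_bump.intervalIntegrable _ _)
    (continuous_bump.stronglyMeasurableAtFilter _ _) continuous_bump.continuousAt).neg

lemma contDiff_bumpTail : ContDiff ℝ 1 bumpTail := by
  refine contDiff_one_iff_deriv.2 ⟨fun t => (hasDerivAt_bumpTail t).differentiableAt, ?_⟩
  rw [funext fun t => (hasDerivAt_bumpTail t).deriv]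
  exact continuous_bump.neg

lemma bumpTail_eq_zero {t : ℝ} (ht : 1 ≤ t) : bumpTail t = 0 := by
  rw [bumpTail, neg_eq_zero]
  refine intervalIntegral.integral_zero_ae (Filter.Eventually.of_forall fun s hs => ?_)
  rw [uIoc_of_le ht] at hs
  exact bump_eq_zero hs.1.le

lemma bumpTail_nonneg (t : ℝ) : 0 ≤ bumpTail t := by
  rcases le_total 1 t with h | h
  · exact (bumpTail_eq_zero h).ge
  · rw [bumpTail, ← intervalIntegral.integral_symm]
    exact intervalIntegral.integral_nonneg h fun s _ => bump_nonneg s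

end Bump

/-! ### Weak gradients and radial test functions. -/

section RadialTest

variable {N : ℕ}

/-- Ensures that profiles vanishing on `[1, ∞)`, evaluated at `c² |x - x₀|²`, vanish off the ball of
radius `r`. -/
lemma one_le_sq_mul_norm_sub_sq {c : ℝ} (hc : 0 < c) {x₀ x : EuclideanSpace ℝ (Fin N)} {r : ℝ}
    (hcr : 1 ≤ c * r) (hx : r ≤ ‖x - x₀‖) : 1 ≤ c ^ 2 * ‖x - x₀‖ ^ 2 := by
  rw [← mul_pow]
  exact one_le_pow₀ (hcr.trans (mul_le_mul_of_nonneg_left hx hc.le))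

variable {Ω : Set (EuclideanSpace ℝ (Fin N))} {w : EuclideanSpace ℝ (Fin N) → ℝ}
  {G : EuclideanSpace ℝ (Fin N) → EuclideanSpace ℝ (Fin N)}

lemma integrableOn_of_forall_notMem_eq_zero {F : Type*} [NormedAddCommGroup F]
    {Ω K : Set (EuclideanSpace ℝ (Fin N))} {h : EuclideanSpace ℝ (Fin N) → F} (hΩ : IsOpen Ω)
    (hK : IntegrableOn h K) (h0 : ∀ x ∉ K, h x = 0) : IntegrableOn h Ω :=
  hK.of_forall_sdiff_eq_zero hΩ.measurableSet fun x hx => h0 x hx.2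

lemma fderiv_eq_zero_of_notMem_tsupport {φ : EuclideanSpace ℝ (Fin N) → ℝ}
    {x : EuclideanSpace ℝ (Fin N)} (hx : x ∉ tsupport φ) : fderiv ℝ φ x = 0 :=
  image_eq_zero_of_notMem_tsupport fun h => hx (tsupport_fderiv_subset ℝ h)

lemma gradient_eq_zero_of_notMem_tsupport {φ : EuclideanSpace ℝ (Fin N) → ℝ}
    {x : EuclideanSpace ℝ (Fin N)} (hx : x ∉ tsupport φ) : gradient φ x = 0 := by
  simp [gradient, fderiv_eq_zero_of_notMem_tsupport hx]

lemma continuous_gradient {φ : EuclideanSpace ℝ (Fin N) → ℝ} (hφ : ContDiff ℝ 1 φ) :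
    Continuous (gradient φ) :=
  (InnerProductSpace.toDual ℝ _).symm.continuous.comp (hφ.continuous_fderiv (by simp))

lemma integrableOn_smul_gradient (hΩ : IsOpen Ω) (h : LocallyIntegrableOn w Ω)
    {φ : EuclideanSpace ℝ (Fin N) → ℝ} (hφ : ContDiff ℝ 1 φ) (hc : HasCompactSupport φ)
    (hs : tsupport φ ⊆ Ω) : IntegrableOn (fun x => w x • gradient φ x) Ω := by
  refine integrableOn_of_forall_notMem_eq_zero hΩ (K := tsupport φ)
    ((h.integrableOn_compact_subset hs hc).smul_continuousOn
      (continuous_gradient hφ).continuousOn hc) fun x hx => ?_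
  simp [gradient_eq_zero_of_notMem_tsupport hx]

lemma integrableOn_smul_of_tsupport_subset {F : Type*} [NormedAddCommGroup F] [NormedSpace ℝ F]
    {H : EuclideanSpace ℝ (Fin N) → F} (hΩ : IsOpen Ω)
    (h : LocallyIntegrableOn H Ω) {φ : EuclideanSpace ℝ (Fin N) → ℝ} (hφ : Continuous φ)
    (hc : HasCompactSupport φ) (hs : tsupport φ ⊆ Ω) : IntegrableOn (fun x => φ x • H x) Ω := by
  refine integrableOn_of_forall_notMem_eq_zero hΩ (K := tsupport φ)
    ((h.integrableOn_compact_subset hs hc).continuousOn_smul hφ.continuousOn hc) fun x hx => ?_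
  simp [image_eq_zero_of_notMem_tsupport hx]

lemma integrableOn_inner_gradient (hΩ : IsOpen Ω) (h : LocallyIntegrableOn G Ω)
    {φ : EuclideanSpace ℝ (Fin N) → ℝ} (hφ : ContDiff ℝ 1 φ) (hc : HasCompactSupport φ)
    (hs : tsupport φ ⊆ Ω) : IntegrableOn (fun x => inner ℝ (G x) (gradient φ x)) Ω := by
  have hg := continuous_gradient hφ
  have hG := h.integrableOn_compact_subset hs hc
  obtain ⟨C, hC⟩ := (show IsCompact (tsupport φ) from hc).exists_bound_of_continuousOn
    hg.continuousOn
  refine integrableOn_of_forall_notMem_eq_zero hΩ (K := tsupport φ) ?_ fun x hx => ?_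
  · refine (hG.norm.const_mul C).mono' (hG.aestronglyMeasurable.inner
      hg.aestronglyMeasurable) ?_
    refine (ae_restrict_iff' (isClosed_tsupport φ).measurableSet).2
      (Filter.Eventually.of_forall fun x hx => ?_)
    rw [mul_comm]
    exact (norm_inner_le_norm _ _).trans
      (mul_le_mul_of_nonneg_left (hC x hx) (norm_nonneg _))
  · simp [gradient_eq_zero_of_notMem_tsupport hx]

/-- The defining identity of the weak gradient, in a fixed direction `e`. -/
lemma IsWeakGradient.integral_mul_fderiv (hΩ : IsOpen Ω) (h : IsWeakGradient Ω w G)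
    {φ : EuclideanSpace ℝ (Fin N) → ℝ} (hφ : ContDiff ℝ ∞ φ) (hc : HasCompactSupport φ)
    (hs : tsupport φ ⊆ Ω) (e : EuclideanSpace ℝ (Fin N)) :
    ∫ x in Ω, w x * fderiv ℝ φ x e = -∫ x in Ω, φ x * inner ℝ e (G x) := by
  have hφ1 : ContDiff ℝ 1 φ := hφ.of_le (by norm_cast)
  have h1 := congrArg (inner ℝ e) (h.integral_eq φ hφ hc hs)
  rw [inner_neg_right,
    ← integral_inner (integrableOn_smul_gradient hΩ h.locallyIntegrable hφ1 hc hs),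
    ← integral_inner (integrableOn_smul_of_tsupport_subset hΩ h.locallyIntegrable_grad
      hφ.continuous hc hs)] at h1
  simpa [inner_smul_right, inner_gradient_right] using h1

lemma IsWeakGradient.sub {w₁ w₂ : EuclideanSpace ℝ (Fin N) → ℝ}
    {G₁ G₂ : EuclideanSpace ℝ (Fin N) → EuclideanSpace ℝ (Fin N)} (hΩ : IsOpen Ω)
    (h₁ : IsWeakGradient Ω w₁ G₁) (h₂ : IsWeakGradient Ω w₂ G₂) :
    IsWeakGradient Ω (w₁ - w₂) (G₁ - G₂) where
  locallyIntegrable := h₁.locallyIntegrable.sub h₂.locallyIntegrable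
  locallyIntegrable_grad := h₁.locallyIntegrable_grad.sub h₂.locallyIntegrable_grad
  integral_eq φ hφ hc hs := by
    have hφ1 : ContDiff ℝ 1 φ := hφ.of_le (by norm_cast)
    simp only [Pi.sub_apply, sub_smul, smul_sub]
    rw [integral_sub (integrableOn_smul_gradient hΩ h₁.locallyIntegrable hφ1 hc hs)
        (integrableOn_smul_gradient hΩ h₂.locallyIntegrable hφ1 hc hs),
      integral_sub
        (integrableOn_smul_of_tsupport_subset hΩ h₁.locallyIntegrable_grad hφ.continuous hc hs)
        (integrableOn_smul_of_tsupport_subset hΩ h₂.locallyIntegrable_grad hφ.continuous hc hs),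
      h₁.integral_eq φ hφ hc hs, h₂.integral_eq φ hφ hc hs]
    abel

/-- The profile `N η + 2 t η'` of the divergence of `x ↦ η (|x|²) x`, where `η` is `bump`. -/
noncomputable def bumpDiv (N : ℕ) (t : ℝ) : ℝ := N * bump t + 2 * t * deriv bump t

lemma continuous_bumpDiv : Continuous (bumpDiv N) := by
  have := continuous_bump
  have := continuous_deriv_bump
  unfold bumpDiv
  fun_prop

lemma bumpDiv_eq_zero {t : ℝ} (ht : 1 ≤ t) : bumpDiv N t = 0 := by
  simp [bumpDiv, bump_eq_zero ht, deriv_bump_eq_zero ht]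

lemma hasFDerivAt_sq_mul_norm_sub_sq (c : ℝ) (x₀ x : EuclideanSpace ℝ (Fin N)) :
    HasFDerivAt (fun x => c ^ 2 * ‖x - x₀‖ ^ 2)
      ((c ^ 2 * 2) • innerSL ℝ (x - x₀)) x := by
  have h := (((hasFDerivAt_id x).sub_const x₀).norm_sq).const_mul (c ^ 2)
  refine h.congr_fderiv ?_
  ext y
  simp [mul_assoc]

lemma tsupport_subset_closedBall {φ : EuclideanSpace ℝ (Fin N) → ℝ}
    {x₀ : EuclideanSpace ℝ (Fin N)} {r : ℝ} (h : ∀ x, r ≤ ‖x - x₀‖ → φ x = 0) :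
    tsupport φ ⊆ Metric.closedBall x₀ r := by
  refine closure_minimal (fun x hx => ?_) Metric.isClosed_closedBall
  rw [Metric.mem_closedBall, dist_eq_norm]
  by_contra hlt
  exact hx (h x (not_le.1 hlt).le)

/-- The weak form of `0 ≤ -Δw` tested with a rescaled radial bump function. -/
lemma integral_mul_bumpDiv_nonneg (hΩ : IsOpen Ω) (h : IsWeakGradient Ω w G)
    (hsup : ∀ φ : EuclideanSpace ℝ (Fin N) → ℝ, ContDiff ℝ 1 φ → HasCompactSupport φ →
      tsupport φ ⊆ Ω → (∀ x, 0 ≤ φ x) → 0 ≤ ∫ x in Ω, inner ℝ (G x) (gradient φ x))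
    {x₀ : EuclideanSpace ℝ (Fin N)} {r c : ℝ} (hr : Metric.closedBall x₀ r ⊆ Ω) (hc : 0 < c)
    (hcr : 1 ≤ c * r) :
    0 ≤ ∫ x in Metric.closedBall x₀ r, w x * bumpDiv N (c ^ 2 * ‖x - x₀‖ ^ 2) := by
  have hout : ∀ x, r ≤ ‖x - x₀‖ → 1 ≤ c ^ 2 * ‖x - x₀‖ ^ 2 := fun x =>
    one_le_sq_mul_norm_sub_sq hc hcr
  have hcpt : ∀ {φ : EuclideanSpace ℝ (Fin N) → ℝ}, tsupport φ ⊆ Metric.closedBall x₀ r →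
      HasCompactSupport φ := fun hs =>
    (isCompact_closedBall x₀ r).of_isClosed_subset (isClosed_tsupport _) hs
  have hsq : ContDiff ℝ ∞ fun x : EuclideanSpace ℝ (Fin N) => c ^ 2 * ‖x - x₀‖ ^ 2 :=
    contDiff_const.mul ((contDiff_id.sub contDiff_const).norm_sq ℝ)
  set φ : EuclideanSpace ℝ (Fin N) → ℝ := fun x => bumpTail (c ^ 2 * ‖x - x₀‖ ^ 2) with hφ
  have hφs : tsupport φ ⊆ Metric.closedBall x₀ r :=
    tsupport_subset_closedBall fun x hx => bumpTail_eq_zero (hout x hx)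
  have hmain := hsup φ (contDiff_bumpTail.comp (hsq.of_le (by norm_cast))) (hcpt hφs)
    (hφs.trans hr) fun x => bumpTail_nonneg _
  -- The components of the field `η(c²|x - x₀|²)(x - x₀)`, where `η` is `bump`. It is `-∇φ / (2c²)`,
  -- and its divergence is the `bumpDiv` profile.
  set ψ : Fin N → EuclideanSpace ℝ (Fin N) → ℝ := fun i x =>
    bump (c ^ 2 * ‖x - x₀‖ ^ 2) * (x i - x₀ i) with hψ
  have hψd : ∀ i, ContDiff ℝ ∞ (ψ i) := fun i =>
    (contDiff_bump.comp hsq).mul (by fun_prop)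
  have hψs : ∀ i, tsupport (ψ i) ⊆ Metric.closedBall x₀ r := fun i =>
    tsupport_subset_closedBall fun x hx => by simp [hψ, bump_eq_zero (hout x hx)]
  have hψf : ∀ i x, fderiv ℝ (ψ i) x (EuclideanSpace.single i 1)
      = bump (c ^ 2 * ‖x - x₀‖ ^ 2)
        + 2 * c ^ 2 * (x i - x₀ i) ^ 2 * deriv bump (c ^ 2 * ‖x - x₀‖ ^ 2) := fun i x => by
    have h1 := ((hasDerivAt_bump _).comp_hasFDerivAt x (hasFDerivAt_sq_mul_norm_sub_sq c x₀ x)).mul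
      (((EuclideanSpace.proj i : EuclideanSpace ℝ (Fin N) →L[ℝ] ℝ).hasFDerivAt (x := x)).sub_const
        (x₀ i))
    have h2 : HasFDerivAt (ψ i) _ x := h1
    rw [h2.fderiv]
    simp [EuclideanSpace.inner_single_right]
    ring
  have hψint : ∀ i, ∫ x in Ω, w x * fderiv ℝ (ψ i) x (EuclideanSpace.single i 1)
      = -∫ x in Ω, ψ i x * inner ℝ (EuclideanSpace.single i 1) (G x) := fun i =>
    h.integral_mul_fderiv hΩ (hψd i) (hcpt (hψs i)) ((hψs i).trans hr) _
  have hI1 : ∀ i, IntegrableOn (fun x => w x * fderiv ℝ (ψ i) x (EuclideanSpace.single i 1)) Ω :=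
    fun i => by
      have := (integrableOn_smul_gradient hΩ h.locallyIntegrable ((hψd i).of_le (by norm_cast))
        (hcpt (hψs i)) ((hψs i).trans hr)).inner_const (𝕜 := ℝ) (EuclideanSpace.single i (1 : ℝ))
      simpa [IntegrableOn, inner_smul_left, inner_gradient_left] using this
  have hI2 : ∀ i, IntegrableOn (fun x => ψ i x * inner ℝ (EuclideanSpace.single i 1) (G x)) Ω :=
    fun i => by
      have := (integrableOn_smul_of_tsupport_subset hΩ h.locallyIntegrable_grad
        (hψd i).continuous (hcpt (hψs i)) ((hψs i).trans hr)).const_inner (𝕜 := ℝ)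
        (EuclideanSpace.single i (1 : ℝ))
      simpa only [IntegrableOn, inner_smul_right] using this
  have hsum1 : ∀ x, w x * bumpDiv N (c ^ 2 * ‖x - x₀‖ ^ 2)
      = ∑ i, w x * fderiv ℝ (ψ i) x (EuclideanSpace.single i 1) := fun x => by
    simp only [hψf]
    rw [← Finset.mul_sum, Finset.sum_add_distrib, ← Finset.sum_mul, ← Finset.mul_sum, bumpDiv,
      EuclideanSpace.norm_sq_eq]
    simp only [Finset.sum_const, Finset.card_univ, Fintype.card_fin, nsmul_eq_mul,
      Real.norm_eq_abs, sq_abs, PiLp.sub_apply]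
    ring
  -- By the chain rule and `bumpTail' = -bump`, `∇φ = -2c² ψ`.
  have hsum2 : ∀ x, inner ℝ (G x) (gradient φ x)
      = -(2 * c ^ 2) * ∑ i, ψ i x * inner ℝ (EuclideanSpace.single i 1) (G x) := fun x => by
    have h2 : HasFDerivAt φ _ x :=
      (hasDerivAt_bumpTail _).comp_hasFDerivAt x (hasFDerivAt_sq_mul_norm_sub_sq c x₀ x)
    rw [inner_gradient_right, h2.fderiv]
    have h3 : inner ℝ (x - x₀) (G x) = ∑ i, (x i - x₀ i) * G x i := by
      simp only [PiLp.inner_apply, PiLp.sub_apply, RCLike.inner_apply, conj_trivial, mul_comm]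
    simp only [hψ, EuclideanSpace.inner_single_left, mul_assoc, map_one, one_mul]
    rw [← Finset.mul_sum, ← h3]
    simp only [FunLike.coe_smul, Pi.smul_apply, innerSL_apply_apply, smul_eq_mul, conj_trivial]
    ring
  have hK : ∫ x in Metric.closedBall x₀ r, w x * bumpDiv N (c ^ 2 * ‖x - x₀‖ ^ 2)
      = ∫ x in Ω, w x * bumpDiv N (c ^ 2 * ‖x - x₀‖ ^ 2) := by
    refine (setIntegral_eq_of_subset_of_forall_sdiff_eq_zero hΩ.measurableSet hr fun x hx => ?_).symm
    have : r ≤ ‖x - x₀‖ := by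
      have := hx.2
      rw [Metric.mem_closedBall, dist_eq_norm] at this
      exact (not_le.1 this).le
    simp [bumpDiv_eq_zero (hout x this)]
  simp only [hsum2] at hmain
  rw [integral_const_mul, integral_finsetSum _ fun i _ => hI2 i] at hmain
  rw [hK]
  simp only [hsum1]
  rw [integral_finsetSum _ fun i _ => hI1 i]
  simp only [hψint]
  rw [Finset.sum_neg_distrib]
  have : 0 < 2 * c ^ 2 := by positivity
  rw [neg_mul, neg_nonneg] at hmain
  rw [neg_nonneg]
  exact nonpos_of_mul_nonpos_right hmain this

end RadialTest

/-! ### Monotone averages and the strong minimum principle. -/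

section StrongMinimum

variable {N : ℕ} {Ω : Set (EuclideanSpace ℝ (Fin N))}
  {w : EuclideanSpace ℝ (Fin N) → ℝ}
  {G : EuclideanSpace ℝ (Fin N) → EuclideanSpace ℝ (Fin N)}

/-- The average of `w` against bumps concentrating at `x₀`, up to a constant factor. -/
noncomputable def bumpAverage (w : EuclideanSpace ℝ (Fin N) → ℝ) (x₀ : EuclideanSpace ℝ (Fin N))
    (r c : ℝ) : ℝ :=
  ∫ x in Metric.closedBall x₀ r, w x * (c ^ N * bump (c ^ 2 * ‖x - x₀‖ ^ 2))

lemma integrable_bump_norm_sq :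
    Integrable fun x : EuclideanSpace ℝ (Fin N) => bump (‖x‖ ^ 2) := by
  have hb := continuous_bump
  refine Continuous.integrable_of_hasCompactSupport (by fun_prop)
    (HasCompactSupport.intro (isCompact_closedBall 0 1) fun x hx => bump_eq_zero ?_)
  rw [Metric.mem_closedBall, dist_zero_right, not_le] at hx
  exact one_le_pow₀ hx.le

lemma integrable_pow_mul_bump {c : ℝ} (hc : 0 < c) (x₀ : EuclideanSpace ℝ (Fin N)) :
    Integrable fun x => c ^ N * bump (c ^ 2 * ‖x - x₀‖ ^ 2) := by
  have h := ((integrable_bump_norm_sq (N := N)).comp_smul hc.ne').comp_sub_right x₀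
  simpa [norm_smul, mul_pow] using h.const_mul (c ^ N)

/-- The factor `c ^ N` cancels the Jacobian of the dilation, so the total mass does not depend on
`c`. -/
lemma integral_pow_mul_bump {c : ℝ} (hc : 0 < c) (x₀ : EuclideanSpace ℝ (Fin N)) :
    ∫ x, c ^ N * bump (c ^ 2 * ‖x - x₀‖ ^ 2)
      = ∫ x : EuclideanSpace ℝ (Fin N), bump (‖x‖ ^ 2) := by
  have h := Measure.integral_comp_smul (volume : Measure (EuclideanSpace ℝ (Fin N)))
    (fun x => bump (‖x‖ ^ 2)) c
  rw [integral_sub_right_eq_self (fun x => c ^ N * bump (c ^ 2 * ‖x‖ ^ 2)) x₀,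
    integral_const_mul]
  simp only [norm_smul, mul_pow, Real.norm_eq_abs, sq_abs, finrank_euclideanSpace,
    Fintype.card_fin, smul_eq_mul] at h
  rw [h, abs_of_pos (by positivity), ← mul_assoc, mul_inv_cancel₀ (by positivity), one_mul]

variable [NeZero N]

/-- Differentiating in the scale yields the divergence profile again; this links the averages to the
weak inequality. -/
lemma hasDerivAt_pow_mul_bump (q c : ℝ) :
    HasDerivAt (fun c : ℝ => c ^ N * bump (c ^ 2 * q))
      (c ^ (N - 1) * bumpDiv N (c ^ 2 * q)) c := by
  have h1 : HasDerivAt (fun c : ℝ => c ^ 2 * q) (2 * c * q) c := by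
    simpa using (hasDerivAt_pow 2 c).mul_const q
  have h2 := (hasDerivAt_pow N c).mul ((hasDerivAt_bump _).comp c h1)
  refine h2.congr_deriv ?_
  have h3 : c ^ N = c ^ (N - 1) * c := by
    rw [← pow_succ, Nat.sub_add_cancel (NeZero.one_le)]
  simp only [bumpDiv, Function.comp_apply]
  rw [h3]
  ring

lemma hasDerivAt_bumpAverage {x₀ : EuclideanSpace ℝ (Fin N)} {r : ℝ}
    (hw : ContinuousOn w (Metric.closedBall x₀ r)) (c : ℝ) :
    HasDerivAt (bumpAverage w x₀ r)
      (∫ x in Metric.closedBall x₀ r,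
        w x * (c ^ (N - 1) * bumpDiv N (c ^ 2 * ‖x - x₀‖ ^ 2))) c := by
  have hK := isCompact_closedBall x₀ r
  have hb := continuous_bump
  have hb' := continuous_bumpDiv (N := N)
  have hcont : Continuous fun p : ℝ × EuclideanSpace ℝ (Fin N) =>
      p.1 ^ (N - 1) * bumpDiv N (p.1 ^ 2 * ‖p.2 - x₀‖ ^ 2) := by fun_prop
  -- A bound uniform for scales within distance 1 of `c` dominates the differentiated integrand.
  obtain ⟨C, hC⟩ := ((isCompact_closedBall c 1).prod hK).exists_bound_of_continuousOn
    hcont.continuousOn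
  have hmeas : ∀ g : EuclideanSpace ℝ (Fin N) → ℝ, Continuous g →
      IntegrableOn (fun x => w x * g x) (Metric.closedBall x₀ r) := fun g hg =>
    (hw.mul hg.continuousOn).integrableOn_compact hK
  refine (hasDerivAt_integral_of_dominated_loc_of_deriv_le
    (F := fun c x => w x * (c ^ N * bump (c ^ 2 * ‖x - x₀‖ ^ 2)))
    (F' := fun c x => w x * (c ^ (N - 1) * bumpDiv N (c ^ 2 * ‖x - x₀‖ ^ 2)))
    (bound := fun x => |w x| * C)
    (Metric.closedBall_mem_nhds c one_pos) (Filter.Eventually.of_forall fun d => ?_) ?_ ?_ ?_ ?_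
    ?_).2
  · exact (hmeas _ (by fun_prop)).aestronglyMeasurable
  · exact hmeas _ (by fun_prop)
  · exact (hmeas _ (by fun_prop)).aestronglyMeasurable
  · refine (ae_restrict_iff' Metric.isClosed_closedBall.measurableSet).2
      (Filter.Eventually.of_forall fun x hx d hd => ?_)
    rw [norm_mul, Real.norm_eq_abs (w x)]
    exact mul_le_mul_of_nonneg_left (hC (d, x) ⟨hd, hx⟩) (abs_nonneg _)
  · exact ((hw.abs).mul continuousOn_const).integrableOn_compact hK
  · exact Filter.Eventually.of_forall fun x d _ => (hasDerivAt_pow_mul_bump _ d).const_mul _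

/-- The derivative is `c ^ (N - 1)` times the quantity in `integral_mul_bumpDiv_nonneg`. For `c ≥ 1
/ r` the bump, of radius `1 / c`, lives inside the ball. -/
lemma bumpAverage_monotoneOn (hΩ : IsOpen Ω) (hw : ContinuousOn w Ω) (h : IsWeakGradient Ω w G)
    (hsup : ∀ φ : EuclideanSpace ℝ (Fin N) → ℝ, ContDiff ℝ 1 φ → HasCompactSupport φ →
      tsupport φ ⊆ Ω → (∀ x, 0 ≤ φ x) → 0 ≤ ∫ x in Ω, inner ℝ (G x) (gradient φ x))
    {x₀ : EuclideanSpace ℝ (Fin N)} {r : ℝ} (hr0 : 0 < r) (hr : Metric.closedBall x₀ r ⊆ Ω) :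
    MonotoneOn (bumpAverage w x₀ r) (Ici (1 / r)) := by
  have hd := hasDerivAt_bumpAverage (hw.mono hr)
  refine monotoneOn_of_deriv_nonneg (convex_Ici _)
    (fun c _ => (hd c).continuousAt.continuousWithinAt)
    (fun c _ => (hd c).differentiableAt.differentiableWithinAt) fun c hc => ?_
  rw [interior_Ici, mem_Ioi, div_lt_iff₀ hr0] at hc
  have hc0 : 0 < c := pos_of_mul_pos_left (one_pos.trans hc) hr0.le
  rw [(hd c).deriv]
  have h1 := integral_mul_bumpDiv_nonneg hΩ h hsup hr hc0 hc.le
  have h2 : ∀ x, w x * (c ^ (N - 1) * bumpDiv N (c ^ 2 * ‖x - x₀‖ ^ 2))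
      = c ^ (N - 1) * (w x * bumpDiv N (c ^ 2 * ‖x - x₀‖ ^ 2)) := fun x => by ring
  simp only [h2, integral_const_mul]
  positivity

/-- A nonnegative continuous weakly superharmonic function vanishes near each of its zeros. -/
lemma exists_ball_forall_eq_zero (hΩ : IsOpen Ω) (hw : ContinuousOn w Ω)
    (h : IsWeakGradient Ω w G)
    (hsup : ∀ φ : EuclideanSpace ℝ (Fin N) → ℝ, ContDiff ℝ 1 φ → HasCompactSupport φ →
      tsupport φ ⊆ Ω → (∀ x, 0 ≤ φ x) → 0 ≤ ∫ x in Ω, inner ℝ (G x) (gradient φ x))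
    (hw0 : ∀ x ∈ Ω, 0 ≤ w x) {x₀ : EuclideanSpace ℝ (Fin N)} (hx₀ : x₀ ∈ Ω) (hwx₀ : w x₀ = 0) :
    ∃ r > 0, Metric.ball x₀ r ⊆ Ω ∧ ∀ x ∈ Metric.ball x₀ r, w x = 0 := by
  obtain ⟨r, hr0, hr⟩ := Metric.nhds_basis_closedBall.mem_iff.1 (hΩ.mem_nhds hx₀)
  have hball : Metric.ball x₀ r ⊆ Metric.closedBall x₀ r := Metric.ball_subset_closedBall
  refine ⟨r, hr0, hball.trans hr, ?_⟩
  have hmono := bumpAverage_monotoneOn hΩ hw h hsup hr0 hr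
  have hb := continuous_bump
  set K₀ := ∫ x : EuclideanSpace ℝ (Fin N), bump (‖x‖ ^ 2)
  have hcpt := isCompact_closedBall x₀ r
  have hint : ∀ c : ℝ, IntegrableOn (fun x => w x * (c ^ N * bump (c ^ 2 * ‖x - x₀‖ ^ 2)))
      (Metric.closedBall x₀ r) := fun c =>
    ((hw.mono hr).mul (by fun_prop)).integrableOn_compact hcpt
  have hsmall : ∀ ε > 0, bumpAverage w x₀ r (1 / r) ≤ ε * K₀ := fun ε hε => by
    have hev : ∀ᶠ x in nhds x₀, w x < ε := (hw.continuousAt (hΩ.mem_nhds hx₀)).eventually_lt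
      continuousAt_const (by rwa [hwx₀])
    obtain ⟨δ, hδ0, hδ⟩ := Metric.eventually_nhds_iff.1 hev
    -- At this scale the bump is supported where `w < ε`, and monotonicity carries the bound back to
    -- the scale `1 / r`.
    set c := max (1 / r) (1 / δ)
    have hc0 : 0 < c := lt_max_of_lt_left (by positivity)
    have hcδ : 1 ≤ c * δ := by
      rw [← div_le_iff₀ hδ0]; exact le_max_right _ _
    refine (hmono self_mem_Ici (le_max_left _ _ : 1 / r ≤ c) (le_max_left _ _)).trans ?_
    have hI := (integrable_pow_mul_bump hc0 x₀).const_mul ε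
    have hnn : ∀ x, 0 ≤ c ^ N * bump (c ^ 2 * ‖x - x₀‖ ^ 2) := fun x =>
      mul_nonneg (by positivity) (bump_nonneg _)
    calc bumpAverage w x₀ r c
        ≤ ∫ x in Metric.closedBall x₀ r, ε * (c ^ N * bump (c ^ 2 * ‖x - x₀‖ ^ 2)) := by
          refine setIntegral_mono_on (hint c) hI.integrableOn
            Metric.isClosed_closedBall.measurableSet fun x _ => ?_
          rcases lt_or_ge ‖x - x₀‖ δ with hx | hx
          · exact mul_le_mul_of_nonneg_right (hδ (by rwa [dist_eq_norm])).le (hnn x)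
          · simp [bump_eq_zero (one_le_sq_mul_norm_sub_sq hc0 hcδ hx)]
      _ ≤ ∫ x, ε * (c ^ N * bump (c ^ 2 * ‖x - x₀‖ ^ 2)) :=
          setIntegral_le_integral hI
            (Filter.Eventually.of_forall fun x => mul_nonneg hε.le (hnn x))
      _ = ε * K₀ := by rw [integral_const_mul, integral_pow_mul_bump hc0]
  have hle : bumpAverage w x₀ r (1 / r) ≤ 0 := by
    have hlim : Filter.Tendsto (fun ε : ℝ => ε * K₀) (nhdsWithin 0 (Ioi 0)) (nhds 0) := by
      have : Continuous fun ε : ℝ => ε * K₀ := by fun_prop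
      simpa using this.continuousWithinAt.tendsto (x := (0 : ℝ)) (s := Ioi 0)
    exact ge_of_tendsto hlim (eventually_mem_nhdsWithin.mono fun ε hε => hsmall ε hε)
  have hnn : ∀ x ∈ Metric.closedBall x₀ r,
      0 ≤ w x * ((1 / r) ^ N * bump ((1 / r) ^ 2 * ‖x - x₀‖ ^ 2)) := fun x hx =>
    mul_nonneg (hw0 x (hr hx)) (mul_nonneg (by positivity) (bump_nonneg _))
  have hmK := (Metric.isClosed_closedBall (x := x₀) (ε := r)).measurableSet
  have hzero : bumpAverage w x₀ r (1 / r) = 0 :=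
    le_antisymm hle (setIntegral_nonneg hmK hnn)
  have hae := (setIntegral_eq_zero_iff_of_nonneg_ae
    ((ae_restrict_iff' hmK).2 (Filter.Eventually.of_forall hnn)) (hint (1 / r))).1 hzero
  -- Continuity turns almost everywhere vanishing into vanishing on the open ball, where the bump at
  -- scale `1 / r` is positive.
  have hon := Measure.eqOn_open_of_ae_eq (ae_restrict_of_ae_restrict_of_subset hball hae)
    Metric.isOpen_ball ((hw.mono (hball.trans hr)).mul (by fun_prop)) continuousOn_const
  intro x hx
  refine (mul_eq_zero.1 (hon hx)).resolve_right (mul_pos (by positivity) (bump_pos ?_)).ne'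
  rw [Metric.mem_ball, dist_eq_norm] at hx
  rw [← mul_pow]
  refine pow_lt_one₀ (by positivity) ?_ two_ne_zero
  rw [one_div, inv_mul_lt_iff₀ hr0]
  simpa using hx

/-- The strong minimum principle for continuous weakly superharmonic functions. -/
lemma eq_zero_or_pos_of_weakly_superharmonic (hΩ : IsOpen Ω) (hconn : IsPreconnected Ω)
    (hw : ContinuousOn w Ω) (h : IsWeakGradient Ω w G)
    (hsup : ∀ φ : EuclideanSpace ℝ (Fin N) → ℝ, ContDiff ℝ 1 φ → HasCompactSupport φ →
      tsupport φ ⊆ Ω → (∀ x, 0 ≤ φ x) → 0 ≤ ∫ x in Ω, inner ℝ (G x) (gradient φ x))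
    (hw0 : ∀ x ∈ Ω, 0 ≤ w x) : (∀ x ∈ Ω, w x = 0) ∨ ∀ x ∈ Ω, 0 < w x := by
  by_cases hz : ∃ x ∈ Ω, w x = 0
  · left
    obtain ⟨x₀, hx₀, hwx₀⟩ := hz
    have hU : IsOpen {x ∈ Ω | w x = 0} := Metric.isOpen_iff.2 fun x hx => by
      obtain ⟨r, hr0, hr, hr'⟩ := exists_ball_forall_eq_zero hΩ hw h hsup hw0 hx.1 hx.2
      exact ⟨r, hr0, fun y hy => ⟨hr hy, hr' y hy⟩⟩
    have hV : IsOpen {x ∈ Ω | 0 < w x} := hw.isOpen_inter_preimage hΩ isOpen_Ioi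
    -- The zero set and the positivity set are disjoint, open and cover `Ω`; the former contains
    -- `x₀`.
    have hsub := hconn.subset_left_of_subset_union hU hV
      (disjoint_left.2 fun x hx hx' => hx'.2.ne' hx.2)
      (fun x hx => (hw0 x hx).eq_or_lt.imp (fun e => ⟨hx, e.symm⟩) fun e => ⟨hx, e⟩)
      ⟨x₀, hx₀, hx₀, hwx₀⟩
    exact fun x hx => (hsub hx).2
  · right
    push Not at hz
    exact fun x hx => (hw0 x hx).lt_of_ne' (hz x hx)

end StrongMinimum

end Hartree

/-! ### The comparison principle. -/

theorem theorem4p1 (N : ℕ) [NeZero N] (μ : ℝ) (hμ : 0 < μ) (hμN : μ < N)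
    (f : ℝ → ℝ) (hfc : ContinuousOn f (Set.Ici 0)) (hf0 : f 0 = 0)
    (hfm : MonotoneOn f (Set.Ici 0) ∨ AntitoneOn f (Set.Ici 0))
    (Γ : Set (EuclideanSpace ℝ (Fin N))) (hΓ : IsCompact Γ) (hΓ0 : ∀ x ∈ Γ, x 0 = 0)
    (lam : ℝ) (hconn : IsConnected (Hartree.puncturedHalfSpace lam Γ))
    (u : EuclideanSpace ℝ (Fin N) → ℝ) (hu0 : ∀ x ∉ Γ, 0 ≤ u x)
    (huc : ContinuousOn u (Hartree.puncturedHalfSpace lam Γ))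
    (hulc : ContinuousOn (Hartree.reflected lam u) (Hartree.puncturedHalfSpace lam Γ))
    (hsuper : Hartree.IsWeakSupersolution μ f (Hartree.reflection lam '' Γ)
      (Hartree.puncturedHalfSpace lam Γ) (Hartree.reflected lam u))
    (hsub : Hartree.IsWeakSubsolution μ f Γ (Hartree.puncturedHalfSpace lam Γ) u)
    (hle : ∀ x ∈ Hartree.puncturedHalfSpace lam Γ, u x ≤ Hartree.reflected lam u x) :
    (∀ x ∈ Hartree.puncturedHalfSpace lam Γ, u x = Hartree.reflected lam u x) ∨
      (∀ x ∈ Hartree.puncturedHalfSpace lam Γ, u x < Hartree.reflected lam u x) := by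
  have hΩ : IsOpen (Hartree.puncturedHalfSpace lam Γ) := Hartree.isOpen_puncturedHalfSpace hΓ
  have hΓv := Hartree.volume_eq_zero_of_forall_apply_zero_eq_zero hΓ0
  obtain ⟨Gl, hGl, hsuper⟩ := hsuper
  obtain ⟨G, hG, hsub⟩ := hsub
  have hrhs : ∀ᵐ x ∂(volume.restrict (Hartree.puncturedHalfSpace lam Γ)),
      Hartree.potential μ f Γ u x * f (u x) ≤
        Hartree.potential μ f (Hartree.reflection lam '' Γ) (Hartree.reflected lam u) x
          * f (Hartree.reflected lam u x) := by
    filter_upwards [hG.integrable_potential, hGl.integrable_potential,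
      ae_restrict_mem hΩ.measurableSet,
      ae_restrict_of_ae (measure_eq_zero_iff_ae_notMem.1 hΓv)] with x h1 h2 h3 h4
    exact Hartree.rhs_le_rhs_reflected hμ hfc hf0 hfm hΓv hu0 hle h3 h4 h1 h2
  have key := Hartree.eq_zero_or_pos_of_weakly_superharmonic hΩ hconn.isPreconnected
    (hulc.sub huc) (hGl.isWeakGradient.sub hΩ hG.isWeakGradient)
    (fun φ hφ hc hs hφ0 => by
      -- Subtracting the two inequalities bounds `∫ ∇w · ∇φ` below by the integral of `φ` times the
      -- difference of the right-hand sides, which is nonnegative by `hrhs`.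
      have h1 := hsuper φ hφ hc hs hφ0
      have h2 := hsub φ hφ hc hs hφ0
      simp only [Hartree.weakForm] at h1 h2
      simp only [Pi.sub_apply, inner_sub_left]
      rw [integral_sub
        (Hartree.integrableOn_inner_gradient hΩ hGl.isWeakGradient.locallyIntegrable_grad hφ hc hs)
        (Hartree.integrableOn_inner_gradient hΩ hG.isWeakGradient.locallyIntegrable_grad hφ hc hs)]
      have h3 := Hartree.integrableOn_smul_of_tsupport_subset hΩ hG.locallyIntegrable_rhs
        hφ.continuous hc hs
      have h4 := Hartree.integrableOn_smul_of_tsupport_subset hΩ hGl.locallyIntegrable_rhs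
        hφ.continuous hc hs
      simp only [smul_eq_mul, mul_comm (φ _)] at h3 h4
      have h5 := integral_mono_ae h3 h4
        (hrhs.mono fun x hx => mul_le_mul_of_nonneg_right hx (hφ0 x))
      linarith)
    fun x hx => sub_nonneg.2 (hle x hx)
  exact key.imp (fun h x hx => (sub_eq_zero.1 (h x hx)).symm) fun h x hx => sub_pos.1 (h x hx)
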